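/- Let $p$ be a prime, let $e\ge 1$ and $q=p^e$, and let $\mathbb{F}_q$ be a field with $q$ elements. Let $\Gamma\mathrm{L}_2(\mathbb{F}_q)$ be the group of semilinear bijections of $\mathbb{F}_q^2$, that is, of additive bijections $g$ for which there is a field automorphism $\sigma$ of $\mathbb{F}_q$ with $g(cv)=\sigma(c)g(v)$ for all $c\in\mathbb{F}_q$, $v\in\mathbb{F}_q^2$, and let $\mathrm{P}\Gamma\mathrm{L}_2(\mathbb{F}_q)$ be its quotient by the scalar maps $v\mapsto av$, $a\in\mathbb{F}_q^\times$. The projective line $\mathbb{P}^1(\mathbb{F}_q)$ has $q+1$ points and $\mathrm{P}\Gamma\mathrm{L}_2(\mathbb{F}_q)$ acts faithfully on it; hence every enumeration of its points identifies $\mathrm{P}\Gamma\mathrm{L}_2(\mathbb{F}_q)$ with a subgroup $Q$ of $\mathrm{Sym}(q+1)$. For every such enumeration, $N_{\mathrm{Sym}(q+1)}(Q)=Q$. In particular, the normalizer has order $e(q-1)q(q+1)$. -/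

import Mathlib

open scoped LinearAlgebra.Projectivization

section SemilinearGroup

/-- The general semilinear group `ΓL(V)` of a `K`-vector space `V`: the bijections `g : V → V` that
are additive and satisfy `g (c • v) = σ c • g v` for some field automorphism `σ` of `K`. -/
def GammaL (K V : Type*) [Field K] [AddCommGroup V] [Module K V] : Subgroup (Equiv.Perm V) where
  carrier := {g | (∀ u v : V, g (u + v) = g u + g v) ∧
    ∃ σ : K ≃+* K, ∀ (c : K) (v : V), g (c • v) = σ c • g v}
  one_mem' := ⟨fun _ _ => rfl, RingEquiv.refl K, fun _ _ => rfl⟩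
  mul_mem' := by
    rintro g h ⟨ga, σ, hg⟩ ⟨ha, τ, hh⟩
    exact ⟨fun u v => by simp [ha, ga], τ.trans σ, fun c v => by simp [hh, hg]⟩
  inv_mem' := by
    rintro g ⟨ga, σ, hg⟩
    refine ⟨fun u v => g.injective ?_, σ.symm, fun c v => g.injective ?_⟩
    · simp [ga]
    · simp [hg]

variable {K V : Type*} [Field K] [AddCommGroup V] [Module K V]

variable (K V) in
/-- The subgroup of `ΓL(V)` of the scalar maps `v ↦ a • v`, for `a` in `Kˣ`. -/
def GammaL.scalars : Subgroup (GammaL K V) where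
  carrier := {g | ∃ a : Kˣ, ∀ v : V, g.1 v = a • v}
  one_mem' := ⟨1, fun v => by simp⟩
  mul_mem' := by
    rintro g h ⟨a, hg⟩ ⟨b, hh⟩
    exact ⟨a * b, fun v => by simp [hg, hh, mul_smul]⟩
  inv_mem' := by
    rintro g ⟨a, hg⟩
    refine ⟨a⁻¹, fun v => ?_⟩
    have h : v = a • (g⁻¹).1 v := (g.1.apply_symm_apply v).symm.trans (hg _)
    exact eq_inv_smul_iff.2 h.symm

instance GammaL.scalars_normal : (GammaL.scalars K V).Normal where
  conj_mem := by
    rintro g ⟨a, hg⟩ ⟨h, ha, σ, hh⟩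
    refine ⟨Units.map σ.toMonoidHom a, fun v => ?_⟩
    simp [hg, Units.smul_def, hh]

variable (K V) in
/-- The projective semilinear group `PΓL(V)`, the quotient of `ΓL(V)` by the scalars. -/
abbrev PGammaL : Type _ := GammaL K V ⧸ GammaL.scalars K V

theorem GammaL.apply_ne_zero (g : GammaL K V) {v : V} (hv : v ≠ 0) : g.1 v ≠ 0 := by
  have h0 : g.1 0 = 0 := by simpa using g.2.1 0 0
  exact fun h => hv (g.1.injective (h.trans h0.symm))

/-- The action of `ΓL(V)` on the projective space `ℙ(V)`, `g • [v] = [g v]`. -/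
instance GammaL.mulAction : MulAction (GammaL K V) (ℙ K V) where
  smul g := Projectivization.lift
    (fun v => Projectivization.mk K (g.1 v.1) (GammaL.apply_ne_zero g v.2)) (by
      obtain ⟨g, ga, σ, hg⟩ := g
      rintro ⟨a, ha⟩ ⟨b, hb⟩ t h
      refine (Projectivization.mk_eq_mk_iff' K _ _ _ _).2 ⟨σ t, ?_⟩
      change a = t • b at h
      simp [h, hg])
  one_smul x := by
    induction x with
    | h v hv => rfl
  mul_smul g h x := by
    induction x with
    | h v hv => rfl

theorem GammaL.smul_mk (g : GammaL K V) {v : V} (hv : v ≠ 0) :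
    g • Projectivization.mk K v hv = Projectivization.mk K (g.1 v) (GammaL.apply_ne_zero g hv) := rfl

variable (K V) in
/-- The permutation representation of `PΓL(V)` on the projective space `ℙ(V)`. -/
def PGammaL.toPerm : PGammaL K V →* Equiv.Perm (ℙ K V) :=
  QuotientGroup.lift (GammaL.scalars K V) (MulAction.toPermHom (GammaL K V) (ℙ K V)) (by
    rintro g ⟨a, hg⟩
    ext x
    induction x with
    | h v hv =>
      change g • Projectivization.mk K v hv = Projectivization.mk K v hv
      rw [GammaL.smul_mk, Projectivization.mk_eq_mk_iff]
      exact ⟨a, (hg v).symm⟩)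

/-- The permutation representation of `PΓL₂(K)` on `{0, …, m - 1}` obtained from its action on the
projective line `ℙ¹(K)` by an enumeration `b` of the points of the projective line. -/
def PGammaL.toSym {m : ℕ} (b : ℙ K (Fin 2 → K) ≃ Fin m) :
    PGammaL K (Fin 2 → K) →* Equiv.Perm (Fin m) :=
  b.permCongrHom.toMonoidHom.comp (PGammaL.toPerm K (Fin 2 → K))

end SemilinearGroup

/-!
Let `Q` be the image of `PΓL₂(F)` in the permutations of the projective line. It is self-normalizing
over every field `F`; finiteness is used only to count.

As `Q` is `3`-transitive (`PGammaL.exists_mem_apply_eq`), it is enough to show that an element `n`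
of the normalizer that fixes `∞`, `0` and `1` lies in `Q`. Such an `n` normalizes the stabilizer of
`∞` in `Q`, that is, the group of maps `x ↦ a * σ x + b`. The group of translations is the only
minimal normal subgroup of that stabilizer, so `n` normalizes it as well
(`PGammaL.exists_conj_transl_eq_of_mem_normalizer`). Since `n` fixes `0`, it is therefore additive
in the affine coordinate `x`. The conjugate of `n` by `x ↦ x⁻¹` satisfies the same hypotheses, so
`n` is additive in the coordinate `x⁻¹` as well. Now `x ↦ -x⁻¹` is a composite of unit translations
in the two coordinates, so `n` commutes with it, and by Hua's identity
(`map_mul_of_map_add_of_map_inv`) an additive map that fixes `1` and commutes with inversion is a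
field automorphism. Thus `n` is induced by a semilinear map
(`PGammaL.mem_range_toPerm_of_mem_normalizer_of_fix`).

For the order, every element of `ΓL₂(F)` is uniquely `v ↦ A (σ v)` with `A` in `GL₂(F)` and `σ` an
automorphism of `F`, and a field with `p ^ e` elements has `e` automorphisms.
-/

/-! ### Additive maps commuting with inversion -/

/-- A form of **Hua's theorem** for fields. -/
theorem map_mul_of_map_add_of_map_inv {F : Type*} [Field F] (f : F → F)
    (hinj : Function.Injective f) (hadd : ∀ x y, f (x + y) = f x + f y) (h1 : f 1 = 1)
    (hinv : ∀ x, f x⁻¹ = (f x)⁻¹) (x y : F) : f (x * y) = f x * f y := by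
  have h0 : f 0 = 0 := by simpa using hadd 0 0
  have hne : ∀ {x}, x ≠ 0 → f x ≠ 0 := fun hx h => hx (hinj (h.trans h0.symm))
  have hneg : ∀ x, f (-x) = -f x := fun x => by
    rw [eq_neg_iff_add_eq_zero, ← hadd, neg_add_cancel, h0]
  have hsub : ∀ x y, f (x - y) = f x - f y := fun x y => by
    rw [sub_eq_add_neg, hadd, hneg, sub_eq_add_neg]
  -- Hua's identity expresses `a ^ 2 * b` through sums and inverses.
  have hua : ∀ a b : F, a ≠ 0 → b ≠ 0 → a * b ≠ 1 →
      a - (a⁻¹ + (b⁻¹ - a)⁻¹)⁻¹ = a ^ 2 * b := fun a b ha hb hab => by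
    have h : 1 - a * b ≠ 0 := sub_ne_zero.2 (Ne.symm hab)
    have e1 : (b⁻¹ - a)⁻¹ = b / (1 - a * b) := by
      rw [inv_eq_iff_eq_inv, inv_div]
      field_simp
    have e2 : a⁻¹ + b / (1 - a * b) = 1 / (a * (1 - a * b)) := by
      field_simp
      ring
    rw [e1, e2, one_div, inv_inv]
    ring
  have hsqmul : ∀ a b : F, f (a ^ 2 * b) = f a ^ 2 * f b := fun a b => by
    rcases eq_or_ne a 0 with rfl | ha
    · simp [h0]
    rcases eq_or_ne b 0 with rfl | hb
    · simp [h0]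
    by_cases hab : a * b = 1
    · obtain rfl : b = a⁻¹ := eq_inv_of_mul_eq_one_right hab
      have ha' := hne ha
      rw [hinv, show a ^ 2 * a⁻¹ = a by field_simp]
      field_simp
    · have hab' : f a * f b ≠ 1 := fun h => by
        have : f b = f a⁻¹ := by rw [hinv]; exact eq_inv_of_mul_eq_one_right h
        rw [hinj this, mul_inv_cancel₀ ha] at hab
        exact hab rfl
      rw [← hua a b ha hb hab, ← hua _ _ (hne ha) (hne hb) hab']
      simp only [hsub, hadd, hinv]
  have hsq : ∀ a : F, f (a ^ 2) = f a ^ 2 := fun a => by simpa [h1] using hsqmul a 1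
  have key : f (x * y) ^ 2 = (f x * f y) ^ 2 := by
    rw [← hsq, mul_pow, hsqmul, hsq, mul_pow]
  by_cases h2 : (2 : F) = 0
  · rw [← sub_eq_zero, ← pow_eq_zero_iff (two_ne_zero), sub_sq, key]
    linear_combination ((f x * f y) ^ 2 - f (x * y) * (f x * f y)) * h2
  · -- Away from characteristic `2`, every element is a combination of squares.
    have hd : ∀ z, f (2 * z) = 2 * f z := fun z => by rw [two_mul, hadd, two_mul]
    have e : f (2 * (2 * (x * y))) = f ((x + 1) ^ 2 * y) - f ((x - 1) ^ 2 * y) := by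
      rw [← hsub]
      congr 1
      ring
    rw [hd, hd, hsqmul, hsqmul, hadd, hsub, h1] at e
    refine mul_left_cancel₀ h2 (mul_left_cancel₀ h2 ?_)
    linear_combination e

/-! ### Semilinear maps in coordinates -/

namespace GammaL

variable {F : Type*} [Field F]

/-- The semilinear bijection `v ↦ A (σ v)` of `F²`, where `σ` acts coordinatewise. -/
def ofMatrix (A : GL (Fin 2) F) (σ : F ≃+* F) : GammaL F (Fin 2 → F) where
  val :=
    { toFun := fun v => A.1.mulVec (fun i => σ (v i))
      invFun := fun v i => σ.symm ((A⁻¹).1.mulVec v i)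
      left_inv := fun v => by
        simp only [Matrix.mulVec_mulVec, ← Units.val_mul, inv_mul_cancel]
        simp
      right_inv := fun v => by
        simp only [RingEquiv.apply_symm_apply, Matrix.mulVec_mulVec, ← Units.val_mul,
          mul_inv_cancel]
        simp }
  property := by
    refine ⟨fun u v => ?_, σ, fun c v => ?_⟩
    · simp only [Equiv.coe_fn_mk, Pi.add_apply, map_add, ← Matrix.mulVec_add]
      rfl
    · simp only [Equiv.coe_fn_mk, Pi.smul_apply, smul_eq_mul, map_mul, ← Matrix.mulVec_smul]
      rfl

theorem ofMatrix_apply (A : GL (Fin 2) F) (σ : F ≃+* F) (v : Fin 2 → F) :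
    (ofMatrix A σ).1 v = A.1.mulVec (fun i => σ (v i)) := rfl

theorem ofMatrix_apply_cons (A : GL (Fin 2) F) (σ : F ≃+* F) (x y : F) :
    (ofMatrix A σ).1 ![x, y] =
      ![A.1 0 0 * σ x + A.1 0 1 * σ y, A.1 1 0 * σ x + A.1 1 1 * σ y] := by
  ext i
  fin_cases i <;> simp [ofMatrix_apply, Matrix.mulVec, dotProduct, Fin.sum_univ_two]

theorem exists_ofMatrix_eq (g : GammaL F (Fin 2 → F)) : ∃ A σ, ofMatrix A σ = g := by
  obtain ⟨g, ga, σ, hg⟩ := g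
  let l : (Fin 2 → F) ≃ₗ[F] (Fin 2 → F) :=
    { toFun := fun v => g (fun i => σ.symm (v i))
      invFun := fun v i => σ (g.symm v i)
      left_inv := fun v => by simp
      right_inv := fun v => by simp
      map_add' := fun u v => by
        rw [← ga]
        congr 1
        ext i
        simp
      map_smul' := fun c v => by
        have h := hg (σ.symm c) (fun i => σ.symm (v i))
        rw [σ.apply_symm_apply] at h
        rw [RingHom.id_apply, ← h]
        congr 1
        ext i
        simp }
  refine ⟨Matrix.GeneralLinearGroup.toLin.symm
    (LinearMap.GeneralLinearGroup.ofLinearEquiv l), σ, Subtype.ext (Equiv.ext fun v => ?_)⟩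
  have h : (Matrix.GeneralLinearGroup.toLin.symm
      (LinearMap.GeneralLinearGroup.ofLinearEquiv l)).1 = LinearMap.toMatrix' l.toLinearMap := rfl
  rw [ofMatrix_apply, h, LinearMap.toMatrix'_mulVec]
  simp [l]

theorem ofMatrix_injective :
    Function.Injective fun x : GL (Fin 2) F × (F ≃+* F) => ofMatrix x.1 x.2 := by
  rintro ⟨A, σ⟩ ⟨B, τ⟩ h
  have h' : ∀ x y : F, (ofMatrix A σ).1 ![x, y] = (ofMatrix B τ).1 ![x, y] := fun x y =>
    congrArg (fun g : GammaL F (Fin 2 → F) => g.1 ![x, y]) h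
  simp only [ofMatrix_apply_cons] at h'
  have e1 := h' 1 0
  have e2 := h' 0 1
  simp only [map_one, map_zero, mul_one, mul_zero, add_zero, zero_add, Matrix.vecCons_inj,
    and_true] at e1 e2
  obtain rfl : A = B := by
    ext i j
    fin_cases i <;> fin_cases j <;> simp [e1, e2]
  refine Prod.ext rfl (RingEquiv.ext fun x => ?_)
  have e := h' x 0
  simp only [map_zero, mul_zero, add_zero, Matrix.vecCons_inj, and_true] at e
  have hdet := A.det.ne_zero
  by_contra hne
  have c0 : A.1 0 0 = 0 := by
    by_contra h0; exact hne (mul_left_cancel₀ h0 e.1)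
  have c1 : A.1 1 0 = 0 := by
    by_contra h0; exact hne (mul_left_cancel₀ h0 e.2)
  apply hdet
  simp [Matrix.det_fin_two, c0, c1]

end GammaL

/-! ### The projective line in an affine chart -/

namespace PGammaL

variable {F : Type*} [Field F]

variable (F) in
/-- The point at infinity `[1 : 0]` of the projective line. -/
def infty : ℙ F (Fin 2 → F) :=
  Projectivization.mk F ![1, 0] (fun h => one_ne_zero (congrFun h 0))

/-- The affine point `[x : 1]` of the projective line. -/
def pt (x : F) : ℙ F (Fin 2 → F) :=
  Projectivization.mk F ![x, 1] (fun h => one_ne_zero (congrFun h 1))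

theorem mk_eq_infty_iff {x y : F} (h : ![x, y] ≠ 0) :
    Projectivization.mk F ![x, y] h = infty F ↔ y = 0 := by
  rw [infty, Projectivization.mk_eq_mk_iff']
  constructor
  · rintro ⟨a, ha⟩
    simpa using (congrFun ha 1).symm
  · rintro rfl
    exact ⟨x, by simp⟩

theorem mk_eq_pt_iff {x y z : F} (h : ![x, y] ≠ 0) :
    Projectivization.mk F ![x, y] h = pt z ↔ x = z * y := by
  rw [pt, Projectivization.mk_eq_mk_iff']
  constructor
  · rintro ⟨a, ha⟩
    have h0 : a * z = x := by simpa using congrFun ha 0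
    have h1 : a = y := by simpa using congrFun ha 1
    rw [← h0, h1, mul_comm]
  · rintro rfl
    exact ⟨y, by simp [mul_comm]⟩

theorem pt_ne_infty (x : F) : pt x ≠ infty F := fun h =>
  one_ne_zero ((mk_eq_infty_iff _).1 h)

theorem pt_injective : Function.Injective (pt : F → ℙ F (Fin 2 → F)) := fun x y h => by
  simpa using (mk_eq_pt_iff _).1 h

theorem eq_infty_or_eq_pt (P : ℙ F (Fin 2 → F)) : P = infty F ∨ ∃ x, P = pt x := by
  induction P with
  | h v hv =>
    obtain ⟨x, y, rfl⟩ : ∃ x y, v = ![x, y] := ⟨v 0, v 1, by ext i; fin_cases i <;> rfl⟩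
    by_cases hy : y = 0
    · exact .inl ((mk_eq_infty_iff hv).2 hy)
    · exact .inr ⟨x / y, (mk_eq_pt_iff hv).2 (by field_simp)⟩

theorem exists_eq_pt {P : ℙ F (Fin 2 → F)} (h : P ≠ infty F) : ∃ x, P = pt x :=
  (eq_infty_or_eq_pt P).resolve_left h

theorem perm_ext {m n : Equiv.Perm (ℙ F (Fin 2 → F))} (h : m (infty F) = n (infty F))
    (h' : ∀ x, m (pt x) = n (pt x)) : m = n := by
  ext P
  obtain rfl | ⟨x, rfl⟩ := eq_infty_or_eq_pt P
  exacts [h, h' x]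

/-- The permutation of the projective line induced by `v ↦ A (σ v)`. -/
def ofMatrix (A : GL (Fin 2) F) (σ : F ≃+* F) : Equiv.Perm (ℙ F (Fin 2 → F)) :=
  toPerm F (Fin 2 → F) (GammaL.ofMatrix A σ : GammaL F (Fin 2 → F))

theorem ofMatrix_mem (A : GL (Fin 2) F) (σ : F ≃+* F) :
    ofMatrix A σ ∈ (toPerm F (Fin 2 → F)).range := ⟨_, rfl⟩

theorem exists_ofMatrix_eq {g : Equiv.Perm (ℙ F (Fin 2 → F))}
    (hg : g ∈ (toPerm F (Fin 2 → F)).range) : ∃ A σ, ofMatrix A σ = g := by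
  obtain ⟨x, rfl⟩ := hg
  obtain ⟨x, rfl⟩ := QuotientGroup.mk_surjective x
  obtain ⟨A, σ, rfl⟩ := GammaL.exists_ofMatrix_eq x
  exact ⟨A, σ, rfl⟩

theorem ofMatrix_mk (A : GL (Fin 2) F) (σ : F ≃+* F) {v : Fin 2 → F} (hv : v ≠ 0) :
    ofMatrix A σ (Projectivization.mk F v hv) =
      Projectivization.mk F ((GammaL.ofMatrix A σ).1 v) (GammaL.apply_ne_zero _ hv) := rfl

theorem ofMatrix_infty_eq_infty_iff (A : GL (Fin 2) F) (σ : F ≃+* F) :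
    ofMatrix A σ (infty F) = infty F ↔ A.1 1 0 = 0 := by
  rw [infty, ofMatrix_mk]
  simp only [GammaL.ofMatrix_apply_cons]
  exact (mk_eq_infty_iff _).trans (by simp)

theorem ofMatrix_infty_eq_pt_iff (A : GL (Fin 2) F) (σ : F ≃+* F) (z : F) :
    ofMatrix A σ (infty F) = pt z ↔ A.1 0 0 = z * A.1 1 0 := by
  rw [infty, ofMatrix_mk]
  simp only [GammaL.ofMatrix_apply_cons]
  exact (mk_eq_pt_iff _).trans (by simp)

theorem ofMatrix_pt_eq_infty_iff (A : GL (Fin 2) F) (σ : F ≃+* F) (x : F) :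
    ofMatrix A σ (pt x) = infty F ↔ A.1 1 0 * σ x + A.1 1 1 = 0 := by
  rw [pt, ofMatrix_mk]
  simp only [GammaL.ofMatrix_apply_cons]
  exact (mk_eq_infty_iff _).trans (by simp)

theorem ofMatrix_pt_eq_pt_iff (A : GL (Fin 2) F) (σ : F ≃+* F) (x z : F) :
    ofMatrix A σ (pt x) = pt z ↔
      A.1 0 0 * σ x + A.1 0 1 = z * (A.1 1 0 * σ x + A.1 1 1) := by
  rw [pt, ofMatrix_mk]
  simp only [GammaL.ofMatrix_apply_cons]
  exact (mk_eq_pt_iff _).trans (by simp)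

/-- The translation `x ↦ x + a` of the projective line. -/
def transl (a : F) : Equiv.Perm (ℙ F (Fin 2 → F)) :=
  ofMatrix (Matrix.GeneralLinearGroup.mkOfDetNeZero !![1, a; 0, 1] (by simp)) (RingEquiv.refl F)

/-- The homothety `x ↦ c * x` of the projective line. -/
def homothety (c : Fˣ) : Equiv.Perm (ℙ F (Fin 2 → F)) :=
  ofMatrix (Matrix.GeneralLinearGroup.mkOfDetNeZero !![(c : F), 0; 0, 1] (by simp))
    (RingEquiv.refl F)

variable (F) in
/-- The inversion `x ↦ x⁻¹` of the projective line, which exchanges `0` and infinity. -/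
def inversion : Equiv.Perm (ℙ F (Fin 2 → F)) :=
  ofMatrix (Matrix.GeneralLinearGroup.mkOfDetNeZero !![0, 1; 1, 0] (by simp)) (RingEquiv.refl F)

@[simp] theorem transl_infty (a : F) : transl a (infty F) = infty F :=
  (ofMatrix_infty_eq_infty_iff _ _).2 rfl

@[simp] theorem transl_pt (a x : F) : transl a (pt x) = pt (x + a) :=
  (ofMatrix_pt_eq_pt_iff _ _ _ _).2 (by simp [Matrix.GeneralLinearGroup.mkOfDetNeZero])

@[simp] theorem homothety_infty (c : Fˣ) : homothety c (infty F) = infty F :=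
  (ofMatrix_infty_eq_infty_iff _ _).2 rfl

@[simp] theorem homothety_pt (c : Fˣ) (x : F) : homothety c (pt x) = pt (c * x) :=
  (ofMatrix_pt_eq_pt_iff _ _ _ _).2 (by simp [Matrix.GeneralLinearGroup.mkOfDetNeZero])

@[simp] theorem inversion_infty : inversion F (infty F) = pt 0 :=
  (ofMatrix_infty_eq_pt_iff _ _ _).2 (by simp [Matrix.GeneralLinearGroup.mkOfDetNeZero])

@[simp] theorem inversion_pt_zero : inversion F (pt 0) = infty F :=
  (ofMatrix_pt_eq_infty_iff _ _ _).2 (by simp [Matrix.GeneralLinearGroup.mkOfDetNeZero])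

theorem inversion_pt {x : F} (hx : x ≠ 0) : inversion F (pt x) = pt x⁻¹ :=
  (ofMatrix_pt_eq_pt_iff _ _ _ _).2 (by simp [Matrix.GeneralLinearGroup.mkOfDetNeZero, hx])

theorem transl_mem (a : F) : transl a ∈ (toPerm F (Fin 2 → F)).range := ofMatrix_mem _ _

theorem homothety_mem (c : Fˣ) : homothety c ∈ (toPerm F (Fin 2 → F)).range := ofMatrix_mem _ _

theorem inversion_mem : inversion F ∈ (toPerm F (Fin 2 → F)).range := ofMatrix_mem _ _

theorem transl_add (a b : F) : transl (a + b) = transl a * transl b :=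
  perm_ext (by simp) fun x => by simp [add_assoc, add_comm a b]

theorem transl_zero : transl (0 : F) = 1 := perm_ext (by simp) fun x => by simp

theorem transl_neg (a : F) : transl (-a) = (transl a)⁻¹ := by
  rw [eq_inv_iff_mul_eq_one, ← transl_add, neg_add_cancel, transl_zero]

theorem homothety_conj_transl (c : Fˣ) (a : F) :
    homothety c * transl a * (homothety c)⁻¹ = transl (c * a) := by
  rw [mul_inv_eq_iff_eq_mul]
  exact perm_ext (by simp) fun x => by simp [mul_add]

/-- The translations form a normal subgroup of the stabilizer of infinity. -/
theorem exists_conj_transl_eq {g : Equiv.Perm (ℙ F (Fin 2 → F))}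
    (hg : g ∈ (toPerm F (Fin 2 → F)).range) (hinf : g (infty F) = infty F) (a : F) :
    ∃ b, g * transl a * g⁻¹ = transl b := by
  obtain ⟨A, σ, rfl⟩ := exists_ofMatrix_eq hg
  have hc := (ofMatrix_infty_eq_infty_iff A σ).1 hinf
  have hd : A.1 1 1 ≠ 0 := fun h => A.det.ne_zero (by simp [Matrix.det_fin_two, hc, h])
  have hpt : ∀ x, ofMatrix A σ (pt x) = pt ((A.1 0 0 * σ x + A.1 0 1) / A.1 1 1) := fun x => by
    rw [ofMatrix_pt_eq_pt_iff, hc]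
    field_simp
    ring
  refine ⟨A.1 0 0 * σ a / A.1 1 1, ?_⟩
  rw [mul_inv_eq_iff_eq_mul]
  refine perm_ext (by simp [hinf]) fun x => ?_
  simp only [Equiv.Perm.mul_apply, transl_pt, hpt, map_add]
  congr 1
  ring

/-- `PΓL₂` is `3`-transitive on the projective line. -/
theorem exists_mem_apply_eq {P Q R : ℙ F (Fin 2 → F)} (hPQ : P ≠ Q) (hPR : P ≠ R) (hQR : Q ≠ R) :
    ∃ g ∈ (toPerm F (Fin 2 → F)).range, g P = infty F ∧ g Q = pt 0 ∧ g R = pt 1 := by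
  obtain ⟨g₁, hg₁, h₁⟩ : ∃ g ∈ (toPerm F (Fin 2 → F)).range, g P = infty F := by
    obtain rfl | ⟨x, rfl⟩ := eq_infty_or_eq_pt P
    · exact ⟨1, one_mem _, rfl⟩
    · exact ⟨inversion F * transl (-x), mul_mem inversion_mem (transl_mem _), by simp⟩
  obtain ⟨y, hy⟩ := exists_eq_pt (P := g₁ Q) (h₁ ▸ g₁.injective.ne hPQ.symm)
  obtain ⟨z, hz⟩ := exists_eq_pt (P := g₁ R) (h₁ ▸ g₁.injective.ne hPR.symm)
  have hyz : z - y ≠ 0 := sub_ne_zero.2 fun h =>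
    hQR (g₁.injective (by rw [hy, hz, h]))
  refine ⟨homothety (Units.mk0 (z - y) hyz)⁻¹ * transl (-y) * g₁,
    mul_mem (mul_mem (homothety_mem _) (transl_mem _)) hg₁, ?_, ?_, ?_⟩
  · simp [h₁]
  · simp [hy]
  · simp only [Equiv.Perm.mul_apply, hz, transl_pt, homothety_pt, ← sub_eq_add_neg]
    simp [hyz]

/-- Only scalar maps fix every point of the projective line. -/
theorem toPerm_injective : Function.Injective (toPerm F (Fin 2 → F)) := by
  rw [injective_iff_map_eq_one]
  intro x hx
  obtain ⟨x, rfl⟩ := QuotientGroup.mk_surjective x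
  obtain ⟨A, σ, rfl⟩ := GammaL.exists_ofMatrix_eq x
  replace hx : ofMatrix A σ = 1 := hx
  have hc := (ofMatrix_infty_eq_infty_iff A σ).1 (by simp [hx])
  have hpt : ∀ x, A.1 0 0 * σ x + A.1 0 1 = x * A.1 1 1 := fun x => by
    have := (ofMatrix_pt_eq_pt_iff A σ x x).1 (by simp [hx])
    simpa [hc] using this
  have hb : A.1 0 1 = 0 := by simpa using hpt 0
  have had : A.1 0 0 = A.1 1 1 := by simpa [hb] using hpt 1
  have ha : A.1 0 0 ≠ 0 := fun h => A.det.ne_zero (by simp [Matrix.det_fin_two, hc, h])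
  have hσ : ∀ x, A.1 0 0 * σ x = A.1 0 0 * x := fun x => by
    simpa [hb, ← had, mul_comm x] using hpt x
  refine (QuotientGroup.eq_one_iff _).2 ⟨Units.mk0 _ ha, fun v => ?_⟩
  obtain ⟨x, y, rfl⟩ : ∃ x y, v = ![x, y] := ⟨v 0, v 1, by ext i; fin_cases i <;> rfl⟩
  rw [GammaL.ofMatrix_apply_cons, hb, hc, ← had, hσ, hσ]
  simp [Units.smul_def]

/-! ### The normalizer -/

section Normalizer

variable {n : Equiv.Perm (ℙ F (Fin 2 → F))}

/-- The translations form the only minimal normal subgroup of the stabilizer of infinity: homotheties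
permute the nontrivial ones transitively by conjugation, and they are their own centralizer.
Hence an element of the normalizer that fixes infinity normalizes the group of translations. -/
theorem exists_conj_transl_eq_of_mem_normalizer
    (hn : n ∈ Subgroup.normalizer ((toPerm F (Fin 2 → F)).range : Set (Equiv.Perm _)))
    (hinf : n (infty F) = infty F) (a : F) : ∃ b, n * transl a * n⁻¹ = transl b := by
  have hinf' : n.symm (infty F) = infty F := n.symm_apply_eq.2 hinf.symm
  have hconj := Subgroup.mem_normalizer_iff.1 hn
  have hconj' := Subgroup.mem_normalizer_iff''.1 hn
  -- It is enough to find one nontrivial translation among the conjugates of translations: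
  -- the homotheties produce all the others.
  suffices h : ∃ β : F, β ≠ 0 ∧ ∃ γ, n * transl β * n⁻¹ = transl γ by
    obtain ⟨β, hβ, γ, h⟩ := h
    rcases eq_or_ne a 0 with rfl | ha
    · exact ⟨0, by simp [transl_zero]⟩
    let d := homothety (Units.mk0 (a / β) (div_ne_zero ha hβ))
    have hd : d * transl β * d⁻¹ = transl a := by
      rw [homothety_conj_transl]
      simp [hβ]
    obtain ⟨b, hb⟩ := exists_conj_transl_eq (g := n * d * n⁻¹)
      ((hconj _).1 (homothety_mem _)) (by simp [hinf, hinf', d]) γ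
    refine ⟨b, ?_⟩
    rw [← hb, ← h, ← hd]
    group
  let t := n⁻¹ * transl 1 * n
  have ht : t ∈ (toPerm F (Fin 2 → F)).range := (hconj' _).1 (transl_mem _)
  have htinf : t (infty F) = infty F := by simp [t, hinf, hinf']
  by_cases hcomm : ∀ x, transl x * t = t * transl x
  · -- The translations are their own centralizer in the stabilizer of infinity.
    obtain ⟨β, hβ⟩ := exists_eq_pt (P := t (pt 0)) (htinf ▸ t.injective.ne (pt_ne_infty 0))
    have htβ : t = transl β := by
      refine perm_ext (by simp [htinf]) fun x => ?_
      have := congrArg (fun g : Equiv.Perm _ => g (pt 0)) (hcomm x)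
      simp only [Equiv.Perm.mul_apply, hβ, transl_pt, zero_add] at this
      rw [← this, transl_pt, add_comm]
    refine ⟨β, ?_, 1, ?_⟩
    · rintro rfl
      rw [transl_zero] at htβ
      have h1 : transl (1 : F) = 1 := by
        have : n * t * n⁻¹ = transl 1 := by simp [t, mul_assoc]
        rw [← this, htβ]
        simp
      have := congrArg (fun g : Equiv.Perm _ => g (pt (0 : F))) h1
      simp only [transl_pt, zero_add, Equiv.Perm.one_apply] at this
      exact one_ne_zero (pt_injective this)
    · rw [← htβ]
      simp [t, mul_assoc]
  · -- A nontrivial commutator of two normal subgroups lies in both of them.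
    push Not at hcomm
    obtain ⟨x, hx⟩ := hcomm
    obtain ⟨β, hβ⟩ := exists_conj_transl_eq ht htinf (-x)
    obtain ⟨γ, hγ⟩ := exists_conj_transl_eq (g := n * transl x * n⁻¹)
      ((hconj _).1 (transl_mem _)) (by simp [hinf, hinf']) 1
    have hu : transl (x + β) = transl x * t * (transl x)⁻¹ * t⁻¹ := by
      rw [transl_add, ← hβ, transl_neg]
      group
    refine ⟨x + β, fun h => hx ?_, γ + -1, ?_⟩
    · rw [h, transl_zero] at hu
      rw [← mul_inv_eq_iff_eq_mul, ← mul_inv_eq_one]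
      exact hu.symm
    · rw [hu, transl_add, ← hγ, transl_neg]
      simp only [t]
      group

theorem map_add_of_mem_normalizer
    (hn : n ∈ Subgroup.normalizer ((toPerm F (Fin 2 → F)).range : Set (Equiv.Perm _)))
    (hinf : n (infty F) = infty F) {f : F → F} (hf : ∀ x, n (pt x) = pt (f x)) (h0 : f 0 = 0)
    (x y : F) : f (x + y) = f x + f y := by
  obtain ⟨b, hb⟩ := exists_conj_transl_eq_of_mem_normalizer hn hinf y
  rw [mul_inv_eq_iff_eq_mul] at hb
  have h : ∀ z, f (z + y) = f z + b := fun z => pt_injective <| by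
    simpa [hf] using congrArg (fun g : Equiv.Perm _ => g (pt z)) hb
  have hy : f y = b := by simpa [h0] using h 0
  rw [h, hy]

/-- An element of the normalizer that fixes `∞`, `0` and `1` is given by a field automorphism: it
is additive in the coordinates at `∞` and at `0`, and therefore commutes with inversion, because
`x ↦ -x⁻¹` is composed of translations in these two coordinates. -/
theorem mem_range_toPerm_of_mem_normalizer_of_fix
    (hn : n ∈ Subgroup.normalizer ((toPerm F (Fin 2 → F)).range : Set (Equiv.Perm _)))
    (hinf : n (infty F) = infty F) (hzero : n (pt 0) = pt 0) (hone : n (pt 1) = pt 1) :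
    n ∈ (toPerm F (Fin 2 → F)).range := by
  choose f hf using fun x => exists_eq_pt (P := n (pt x))
    (by rw [← hinf]; exact n.injective.ne (pt_ne_infty x))
  have h0 : f 0 = 0 := pt_injective (by rw [← hf, hzero])
  have h1 : f 1 = 1 := pt_injective (by rw [← hf, hone])
  have hinj : Function.Injective f := fun x y h =>
    pt_injective (n.injective (by rw [hf, hf, h]))
  have hne : ∀ {x}, x ≠ 0 → f x ≠ 0 := fun hx h => hx (hinj (h.trans h0.symm))
  have hadd := map_add_of_mem_normalizer hn hinf hf h0
  have hadd' : ∀ x y, (f (x + y)⁻¹)⁻¹ = (f x⁻¹)⁻¹ + (f y⁻¹)⁻¹ := by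
    have hs : inversion F ∈
        Subgroup.normalizer ((toPerm F (Fin 2 → F)).range : Set (Equiv.Perm _)) :=
      Subgroup.le_normalizer inversion_mem
    refine map_add_of_mem_normalizer (n := inversion F * n * inversion F)
      (f := fun x => (f x⁻¹)⁻¹) (mul_mem (mul_mem hs hn) hs) (by simp [hzero]) (fun x => ?_)
      (by simp [h0])
    rcases eq_or_ne x 0 with rfl | hx
    · simp [hinf, h0]
    · simp [inversion_pt hx, hf, inversion_pt (hne (inv_ne_zero hx))]
  have hneg : ∀ x, f (-x) = -f x := fun x => by
    rw [eq_neg_iff_add_eq_zero, ← hadd, neg_add_cancel, h0]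
  have hinv : ∀ x, f x⁻¹ = (f x)⁻¹ := fun x => by
    rcases eq_or_ne x 0 with rfl | hx
    · simp [h0]
    rcases eq_or_ne (x + 1) 0 with hx1 | hx1
    · obtain rfl := eq_neg_of_add_eq_zero_left hx1
      simp [hneg, h1, inv_neg]
    have hfx := hne hx
    have hfx1 : f x + 1 ≠ 0 := by
      have := hne hx1
      rwa [hadd, h1] at this
    -- `-x⁻¹ = 1 + ((x + 1)⁻¹ - 1)⁻¹`
    have e := hadd' (x + 1)⁻¹ (-1)
    have e1 : ((x + 1)⁻¹ + -1)⁻¹ = -x⁻¹ + -1 := by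
      rw [show (x + 1)⁻¹ + -1 = -x / (x + 1) by field_simp; ring, inv_div]
      field_simp
      ring
    have e2 : (f x + 1)⁻¹ + -1 = (-(f x)⁻¹ + -1)⁻¹ := by
      rw [show -(f x)⁻¹ + -1 = (f x + 1) / -f x by field_simp; ring, inv_div]
      field_simp
      ring
    rw [e1, inv_inv, inv_neg, inv_one, hneg, h1, hadd x 1, h1, inv_neg, inv_one, e2, inv_inj, hadd,
      hneg, hneg, h1] at e
    exact neg_injective (add_right_cancel e)
  have hmul := map_mul_of_map_add_of_map_inv f hinj hadd h1 hinv
  have hsurj : Function.Surjective f := fun y => by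
    obtain ⟨P, hP⟩ := n.surjective (pt y)
    obtain ⟨x, rfl⟩ := exists_eq_pt (P := P) (by
      rintro rfl
      exact pt_ne_infty y (by rw [← hP, hinf]))
    exact ⟨x, pt_injective (by rw [← hf, hP])⟩
  let σ : F ≃+* F :=
    { Equiv.ofBijective f ⟨hinj, hsurj⟩ with
      map_add' := hadd
      map_mul' := hmul }
  have hn' : n = ofMatrix 1 σ := by
    refine perm_ext ?_ fun x => ?_
    · rw [hinf, eq_comm, ofMatrix_infty_eq_infty_iff]
      simp
    · rw [hf, eq_comm, ofMatrix_pt_eq_pt_iff]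
      simp only [Units.val_one, Matrix.one_apply_eq, ne_eq, one_ne_zero, not_false_eq_true,
        zero_ne_one, Matrix.one_apply_ne, one_mul, zero_mul, add_zero, zero_add, mul_one]
      rfl
  rw [hn']
  exact ofMatrix_mem _ _

end Normalizer

theorem normalizer_range_toPerm :
    Subgroup.normalizer ((toPerm F (Fin 2 → F)).range : Set (Equiv.Perm _)) =
      (toPerm F (Fin 2 → F)).range := by
  refine le_antisymm (fun n hn => ?_) Subgroup.le_normalizer
  obtain ⟨g, hg, h₁, h₂, h₃⟩ := exists_mem_apply_eq (P := n (infty F)) (Q := n (pt 0))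
    (R := n (pt 1)) (n.injective.ne (pt_ne_infty 0).symm) (n.injective.ne (pt_ne_infty 1).symm)
    (n.injective.ne (pt_injective.ne zero_ne_one))
  exact (Subgroup.mul_mem_cancel_left _ hg).1 <| mem_range_toPerm_of_mem_normalizer_of_fix
    (mul_mem (Subgroup.le_normalizer hg) hn) h₁ h₂ h₃

end PGammaL

/-! ### Orders -/

theorem card_ringAut_of_card_eq_pow {F : Type*} [Field F] [Finite F] {p e : ℕ} (hp : p.Prime)
    (hF : Nat.card F = p ^ e) : Nat.card (F ≃+* F) = e := by
  have := Fact.mk hp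
  have := Fintype.ofFinite F
  have : CharP F p := charP_of_card_eq_prime_pow (Nat.card_eq_fintype_card.symm.trans hF)
  let _ : Algebra (ZMod p) F := ZMod.algebra F p
  have hcong : (F ≃ₐ[ZMod p] F) ≃ (F ≃+* F) :=
    { toFun := fun σ => σ.toRingEquiv
      invFun := fun σ => AlgEquiv.ofRingEquiv (f := σ) fun x =>
        DFunLike.congr_fun (Subsingleton.elim ((σ : F →+* F).comp (algebraMap (ZMod p) F))
          (algebraMap (ZMod p) F)) x
      left_inv := fun _ => rfl
      right_inv := fun _ => rfl }
  rw [← Nat.card_congr hcong, IsGalois.card_aut_eq_finrank]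
  refine Nat.pow_right_injective hp.two_le ?_
  have := Module.natCard_eq_pow_finrank (K := ZMod p) (V := F)
  simp only [Nat.card_zmod] at this
  simp only [← this, hF]

namespace GammaL

variable {F : Type*} [Field F]

theorem card_eq : Nat.card (GammaL F (Fin 2 → F)) =
    Nat.card (GL (Fin 2) F) * Nat.card (F ≃+* F) := by
  rw [← Nat.card_prod]
  refine (Nat.card_congr (Equiv.ofBijective _ ⟨ofMatrix_injective, fun g => ?_⟩)).symm
  obtain ⟨A, σ, h⟩ := exists_ofMatrix_eq g
  exact ⟨(A, σ), h⟩

theorem card_scalars : Nat.card (scalars F (Fin 2 → F)) = Nat.card Fˣ := by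
  refine (Nat.card_congr (Equiv.ofBijective (fun a : Fˣ => ⟨⟨MulAction.toPerm a,
    fun u v => smul_add a u v, RingEquiv.refl F, fun c v => smul_comm a c v⟩,
    a, fun v => rfl⟩) ⟨fun a b h => ?_, ?_⟩)).symm
  · have h' := congrArg (fun g : scalars F (Fin 2 → F) => g.1.1 ![1, 1] 0) h
    simpa [Units.smul_def, Units.ext_iff] using h'
  · rintro ⟨g, a, ha⟩
    exact ⟨a, Subtype.ext (Subtype.ext (Equiv.ext fun v => (ha v).symm))⟩

end GammaL

theorem PGammaL.card_eq {F : Type*} [Field F] [Finite F] {p e q : ℕ} (hp : p.Prime)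
    (hq : q = p ^ e) (hF : Nat.card F = q) :
    Nat.card (PGammaL F (Fin 2 → F)) = e * (q - 1) * q * (q + 1) := by
  have := Fintype.ofFinite F
  have h := Subgroup.card_eq_card_quotient_mul_card_subgroup (GammaL.scalars F (Fin 2 → F))
  have hF' : Fintype.card F = q := by rw [← hF, Nat.card_eq_fintype_card]
  have h1 : 1 < q := by rw [← hF]; exact Finite.one_lt_card
  rw [GammaL.card_eq, GammaL.card_scalars, Matrix.card_GL_field,
    card_ringAut_of_card_eq_pow hp (hF.trans hq), Nat.card_units, hF, Fin.prod_univ_two, hF'] at h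
  obtain ⟨r, rfl⟩ : ∃ r, q = r + 1 := ⟨q - 1, by omega⟩
  refine Nat.eq_of_mul_eq_mul_right (show 0 < r + 1 - 1 by omega) (h.symm.trans ?_)
  have e1 : (r + 1) ^ 2 - (r + 1) ^ ((0 : Fin 2) : ℕ) = r * (r + 2) := by
    simp only [Fin.val_zero, pow_zero]
    rw [Nat.sub_eq_iff_eq_add (Nat.one_le_pow _ _ (by omega))]
    ring
  have e2 : (r + 1) ^ 2 - (r + 1) ^ ((1 : Fin 2) : ℕ) = r * (r + 1) := by
    simp only [Fin.val_one, pow_one]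
    rw [Nat.sub_eq_iff_eq_add (Nat.le_self_pow two_ne_zero _)]
    ring
  rw [e1, e2, Nat.add_sub_cancel]
  ring

/-! ### Enumerations of the projective line -/

theorem lemma4p6 (p e q : ℕ) (hp : p.Prime) (he : 1 ≤ e) (hq : q = p ^ e)
    (F : Type*) [Field F] (hF : Nat.card F = q) :
    Nonempty (ℙ F (Fin 2 → F) ≃ Fin (q + 1)) ∧
    ∀ b : ℙ F (Fin 2 → F) ≃ Fin (q + 1),
      Function.Injective (PGammaL.toSym b) ∧
      Subgroup.normalizer ((PGammaL.toSym b).range : Set (Equiv.Perm (Fin (q + 1)))) =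
        (PGammaL.toSym b).range ∧
      Nat.card (Subgroup.normalizer
        ((PGammaL.toSym b).range : Set (Equiv.Perm (Fin (q + 1))))) =
          e * (q - 1) * q * (q + 1) := by
  have hpos : 0 < q := hq ▸ pow_pos hp.pos e
  have : Finite F := Nat.finite_of_card_ne_zero (by omega)
  refine ⟨?_, fun b => ?_⟩
  · have hcard : Nat.card (ℙ F (Fin 2 → F)) = q + 1 := by
      rw [Projectivization.card_of_finrank_two F (Fin 2 → F) (by simp), hF]
    have : Finite (ℙ F (Fin 2 → F)) := Nat.finite_of_card_ne_zero (by omega)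
    exact ⟨Finite.equivFinOfCardEq hcard⟩
  have hinj : Function.Injective (PGammaL.toSym b) :=
    b.permCongrHom.injective.comp PGammaL.toPerm_injective
  have hnorm : Subgroup.normalizer ((PGammaL.toSym b).range : Set (Equiv.Perm (Fin (q + 1)))) =
      (PGammaL.toSym b).range := by
    have h : (PGammaL.toSym b).range =
        (PGammaL.toPerm F (Fin 2 → F)).range.map b.permCongrHom.toMonoidHom :=
      MonoidHom.range_comp _ _
    rw [h, ← Subgroup.map_equiv_normalizer_eq, PGammaL.normalizer_range_toPerm]
  refine ⟨hinj, hnorm, ?_⟩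
  rw [hnorm, ← Nat.card_congr (MonoidHom.ofInjective hinj).toEquiv]
  exact PGammaL.card_eq hp hq hF
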